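/- Let $K$ be a field, let $A=K[x,y]$ with its standard grading $A=\bigoplus_{i\ge 0}A_i$, and let $a_1,\dots,a_d$ be positive integers, $d\ge 2$. For non-negative integers $c_1,\dots,c_n$ let $$R(c_1,\dots,c_n)=K[A_{c_1}s_1,\dots,A_{c_n}s_n]\subset A[s_1,\dots,s_n]$$ be the $K$-subalgebra generated by the products $gs_i$ with $1\le i\le n$ and $g\in A_{c_i}$, graded by the degree in the variables $s_1,\dots,s_n$. Let $L=f_1s_1+\dots+f_ds_d$ with $f_i\in A_{a_i}$ be a form of degree one in $R(a_1,\dots,a_d)$, not zero, such that the ideal $(L)$ of $R(a_1,\dots,a_d)$ is prime. Consider the syzygy module $$\{(z_1,\dots,z_d)\in A^d : z_1f_1+\dots+z_df_d=0\},$$ where an element $(z_1,\dots,z_d)$ is homogeneous of degree $b$ if $z_i\in A_{b-a_i}$ for all $i$ (with $A_k=0$ for $k<0$). Then, whenever $b_1,\dots,b_{d-1}$ are the degrees of the elements of a homogeneous free $A$-basis of this module, there is an isomorphism of graded $K$-algebras $$R(a_1,\dots,a_d)/(L)\;\simeq\; R(b_1,\dots,b_{d-1}).$$ -/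

import Mathlib

noncomputable section

/-- The polynomial ring `A = K[x, y]`, with its standard grading. -/
abbrev PlaneRing (K : Type*) [Field K] : Type _ := MvPolynomial (Fin 2) K

/-- The polynomial ring `B = A[s₁,…,s_d] = K[s₁,…,s_d, x, y]`: the variables `Sum.inl i` are the
`sᵢ`, the variables `Sum.inr 0` and `Sum.inr 1` are `x` and `y`. -/
abbrev BigRing (K : Type*) [Field K] (d : ℕ) : Type _ := MvPolynomial (Fin d ⊕ Fin 2) K

/-- The element `g * sᵢ` of `B`, for `g ∈ A`. -/
def mulVar {K : Type*} [Field K] {d : ℕ} (g : PlaneRing K) (i : Fin d) : BigRing K d :=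
  MvPolynomial.rename Sum.inr g * MvPolynomial.X (Sum.inl i)

/-- The scroll ring `R(a₁,…,a_d) = K[A_{a₁}s₁,…,A_{a_d}s_d]`: the `K`-subalgebra of
`B = A[s₁,…,s_d]` generated by all products `g * sᵢ` with `g ∈ A` homogeneous of degree `aᵢ`. -/
def scrollRing (K : Type*) [Field K] {d : ℕ} (a : Fin d → ℕ) : Subalgebra K (BigRing K d) :=
  Algebra.adjoin K
    {p | ∃ (i : Fin d) (g : PlaneRing K), g.IsHomogeneous (a i) ∧ p = mulVar g i}

/-- The degree `j` component of the scroll ring: its elements that are homogeneous of degree `j`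
in the variables `s₁,…,s_d` (that is, for the weights `1` on each `sᵢ` and `0` on `x`, `y`). -/
def scrollComponent (K : Type*) [Field K] {d : ℕ} (a : Fin d → ℕ) (j : ℕ) :
    Submodule K (scrollRing K a) :=
  (MvPolynomial.weightedHomogeneousSubmodule K
      (Sum.elim (fun _ : Fin d => (1 : ℕ)) (fun _ : Fin 2 => (0 : ℕ))) j).comap
    (scrollRing K a).val.toLinearMap

/-- The degree `j` component of a quotient `R(a₁,…,a_d)/I`: the image of the degree `j`
component of `R(a₁,…,a_d)`. -/
def scrollQuotientComponent (K : Type*) [Field K] {d : ℕ} (a : Fin d → ℕ)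
    (I : Ideal (scrollRing K a)) (j : ℕ) : Submodule K (scrollRing K a ⧸ I) :=
  (scrollComponent K a j).map (Ideal.Quotient.mkₐ K I).toLinearMap

/-- The form `L = f₁s₁ + … + f_ds_d` in the scroll ring `R(a₁,…,a_d)`, for `fᵢ` homogeneous of
degree `aᵢ`. -/
def scrollForm {K : Type*} [Field K] {d : ℕ} (a : Fin d → ℕ) (f : Fin d → PlaneRing K)
    (hf : ∀ i, (f i).IsHomogeneous (a i)) : scrollRing K a :=
  ⟨∑ i, mulVar (f i) i,
    Subalgebra.sum_mem _ fun i _ => Algebra.subset_adjoin ⟨i, f i, hf i, rfl⟩⟩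

/-- The syzygy module of `(f₁,…,f_d)`: all `z ∈ A^d` with `z₁f₁ + … + z_df_d = 0`. -/
def syzygyModule {K : Type*} [Field K] {d : ℕ} (f : Fin d → PlaneRing K) :
    Submodule (PlaneRing K) (Fin d → PlaneRing K) :=
  LinearMap.ker (Fintype.linearCombination (PlaneRing K) f)

/-- `z` is homogeneous of degree `b` as an element of the graded free module
`F = A(-a₁) ⊕ … ⊕ A(-a_d)`: each `zᵢ` lies in `A_{b-aᵢ}`, which is `0` if `b < aᵢ`. -/
def IsShiftedHomogeneous {K : Type*} [Field K] {d : ℕ} (a : Fin d → ℕ)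
    (z : Fin d → PlaneRing K) (b : ℕ) : Prop :=
  ∀ i, z i = 0 ∨ ∃ k : ℕ, k + a i = b ∧ (z i).IsHomogeneous k

end

/-!
Let `z₁,…,z_{d-1}` be the given basis of the syzygies of `f₁,…,f_d`. The isomorphism is induced by
the `A`-algebra map `A[s₁,…,s_d] → A[t₁,…,t_{d-1}]`, `sᵢ ↦ ∑ⱼ zⱼᵢ tⱼ` (`syzygyMap`), which sends
`A_{aᵢ} sᵢ` to `⊕ⱼ A_{bⱼ} tⱼ` and kills `L`.

Kernel. Choose `f_k ≠ 0`. The Koszul syzygies `f_k e_l - f_l e_k` are combinations of the `z_j`, and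
the coefficients define an inverse of the map modulo `L` once `f_k` is inverted. So for `u` in the
kernel some `f_kᴺ u` is a multiple of `L` in `A[s₁,…,s_d]`. The scroll ring is the part of weight `0`
for the weights `1` on `x`, `y` and `-aᵢ` on `sᵢ` (`mem_scrollRing_iff`), so after multiplication by a
suitable `x^p sᵢ^q`, `i ≠ k`, the quotient can be taken in the scroll ring by projection to weight `0`.
The product of `f_kᴺ` and this factor is not in `(L)`, and since `(L)` is prime, `u ∈ (L)`
(`mem_span_scrollForm_of_syzygyMap_eq_zero`).

Image. As the scroll ring is generated in degree `1`, it is enough that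
`⊕ᵢ A_{aᵢ} → ⊕ⱼ A_{bⱼ}` is surjective. Its kernel is the line through `f`, by the computation of the
kernel, so the rank is `∑ (aᵢ + 1) - 1`, and the target has dimension `∑ (bⱼ + 1)`. The inequality
`∑ bⱼ ≤ ∑ aᵢ` (`sum_degree_le_of_span_syzygies`), from the dimension of the syzygies in one large
degree, then gives surjectivity (`exists_transpose_eq`).
-/

noncomputable section

open MvPolynomial

/-! ### Weights, and the scroll ring as a part of weight zero -/

/-- The weights on the variables of `B` for which `x`, `y` have weight `1` and `sᵢ` has weight
`-aᵢ`. The scroll ring is the part of weight `0`. -/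
def scrollWeight {d : ℕ} (a : Fin d → ℕ) : Fin d ⊕ Fin 2 → ℤ :=
  Sum.elim (fun i => -(a i : ℤ)) (fun _ => 1)

/-- The weights on the variables of `B` that give the degree in `s₁,…,s_d`. -/
abbrev varWeight (d : ℕ) : Fin d ⊕ Fin 2 → ℕ :=
  Sum.elim (fun _ : Fin d => (1 : ℕ)) (fun _ : Fin 2 => (0 : ℕ))

section Components

variable {σ R M : Type*} [CommSemiring R] [AddCommGroup M] {w : σ → M}

/-- A factor of weight `0` can be pulled out of a weighted homogeneous component. -/
lemma weightedHomogeneousComponent_mul_of_left_zero {p q : MvPolynomial σ R}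
    (hp : p.IsWeightedHomogeneous w 0) (n : M) :
    weightedHomogeneousComponent w n (p * q) = p * weightedHomogeneousComponent w n q := by
  classical
  let _ := weightedGradedAlgebra R w
  have h := DirectSum.coe_decompose_mul_add_of_left_mem (weightedHomogeneousSubmodule R w)
    (i := 0) (j := n) (b := q) hp
  rw [zero_add] at h
  change ((decompose' R w (p * q) n : _) : MvPolynomial σ R) = p * (decompose' R w q n : _) at h
  simpa only [decompose'_apply] using h

end Components

/-- A homogeneous factor of degree `j` can be pulled out of a component of degree `i + j`. -/
lemma homogeneousComponent_mul_of_isHomogeneous {σ R : Type*} [CommSemiring R]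
    {p q : MvPolynomial σ R} {j : ℕ} (hq : q.IsHomogeneous j) (i : ℕ) :
    homogeneousComponent (i + j) (p * q) = homogeneousComponent i p * q := by
  classical
  let _ := weightedGradedAlgebra R (1 : σ → ℕ)
  have h := DirectSum.coe_decompose_mul_add_of_right_mem
    (weightedHomogeneousSubmodule R (1 : σ → ℕ)) (i := i) (j := j) (a := p) hq
  change ((decompose' R 1 (p * q) (i + j) : _) : MvPolynomial σ R)
    = (decompose' R 1 p i : _) * q at h
  simpa only [homogeneousComponent, decompose'_apply] using h

variable {K : Type*} [Field K] {d e : ℕ}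

lemma weight_scrollWeight (a : Fin d → ℕ) (m : Fin d ⊕ Fin 2 →₀ ℕ) :
    Finsupp.weight (scrollWeight a) m
      = (m (.inr 0) + m (.inr 1) : ℤ) - ∑ i, (m (.inl i) * a i : ℤ) := by
  rw [Finsupp.weight_apply, Finsupp.sum_fintype _ _ (by simp), Fintype.sum_sum_type]
  simp [scrollWeight]
  ring

lemma isWeightedHomogeneous_rename {g : PlaneRing K} {n : ℕ} (hg : g.IsHomogeneous n)
    (a : Fin d → ℕ) :
    (rename (Sum.inr : Fin 2 → Fin d ⊕ Fin 2) g).IsWeightedHomogeneous (scrollWeight a) n := by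
  classical
  intro m hm
  obtain ⟨u, rfl, hu⟩ := coeff_rename_ne_zero _ _ _ hm
  have h := hg hu
  rw [Finsupp.weight_apply, Finsupp.sum_fintype _ _ (by simp)] at h
  rw [Finsupp.weight_apply, Finsupp.sum_mapDomain_index (by simp) (by intros; rw [add_smul]),
    Finsupp.sum_fintype _ _ (by simp)]
  simp only [scrollWeight, Sum.elim_inr]
  rw [← h]
  push_cast
  simp

lemma isWeightedHomogeneous_mulVar {a : Fin d → ℕ} {g : PlaneRing K} {i : Fin d}
    (hg : g.IsHomogeneous (a i)) :
    (mulVar g i).IsWeightedHomogeneous (scrollWeight a) 0 := by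
  have h := (isWeightedHomogeneous_rename hg a).mul
    (isWeightedHomogeneous_X K (scrollWeight a) (.inl i))
  simpa [scrollWeight, mulVar] using h

lemma mulVar_mem_scrollRing {a : Fin d → ℕ} {g : PlaneRing K} {i : Fin d}
    (hg : g.IsHomogeneous (a i)) : mulVar g i ∈ scrollRing K a :=
  Algebra.subset_adjoin ⟨i, g, hg, rfl⟩

lemma monomial_mem_scrollRing (a : Fin d → ℕ) (n : ℕ) (m : Fin d ⊕ Fin 2 →₀ ℕ)
    (hn : ∑ i, m (.inl i) = n) (hm : Finsupp.weight (scrollWeight a) m = 0) :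
    monomial m (1 : K) ∈ scrollRing K a := by
  induction n generalizing m with
  | zero =>
    have h0 : ∀ i, m (.inl i) = 0 := by simpa using hn
    rw [weight_scrollWeight] at hm
    simp only [h0, Nat.cast_zero, zero_mul, Finset.sum_const_zero, sub_zero] at hm
    have : m = 0 := by
      ext v
      rcases v with i | v
      · exact h0 i
      · fin_cases v <;> simp <;> omega
    rw [this]
    exact one_mem _
  | succ n ih =>
    obtain ⟨i, hi⟩ : ∃ i, m (.inl i) ≠ 0 := by
      by_contra! h
      simp [h] at hn
    have hle : a i ≤ m (.inr 0) + m (.inr 1) := by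
      rw [weight_scrollWeight] at hm
      have : (a i : ℤ) ≤ ∑ i, (m (.inl i) * a i : ℤ) :=
        calc (a i : ℤ) ≤ m (.inl i) * a i := by
              have : (1 : ℤ) ≤ m (.inl i) := by omega
              nlinarith
          _ ≤ _ := Finset.single_le_sum (f := fun i => (m (.inl i) * a i : ℤ))
              (fun _ _ => by positivity) (Finset.mem_univ i)
      omega
    -- split off a generator `x^p y^q sᵢ` of the scroll ring, with `p + q = a i`
    obtain ⟨p, q, hp, hq, hpq⟩ : ∃ p q, p ≤ m (.inr 0) ∧ q ≤ m (.inr 1) ∧ p + q = a i :=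
      ⟨min (a i) (m (.inr 0)), a i - min (a i) (m (.inr 0)), by omega, by omega, by omega⟩
    let u : Fin d ⊕ Fin 2 →₀ ℕ :=
      .single (.inr 0) p + .single (.inr 1) q + .single (.inl i) 1
    have hu : u ≤ m := by
      intro v
      rcases v with j | v
      · by_cases hj : i = j
        · subst hj; simp [u]; omega
        · simp [u, hj]
      · fin_cases v <;> simpa [u]
    have hwu : Finsupp.weight (scrollWeight a) u = 0 := by
      simp [u, Finsupp.weight_single, scrollWeight]
      omega
    have hmul : monomial m (1 : K) = monomial u 1 * monomial (m - u) 1 := by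
      rw [monomial_mul, add_tsub_cancel_of_le hu, one_mul]
    rw [hmul]
    refine mul_mem ?_ (ih (m - u) ?_ ?_)
    · have : monomial u (1 : K) = mulVar (X 0 ^ p * X 1 ^ q) i := by
        simp only [u, mulVar, map_mul, map_pow, rename_X]
        simp only [X_pow_eq_monomial]
        simp only [X, monomial_mul, one_mul]
      rw [this]
      exact mulVar_mem_scrollRing (hpq ▸ (isHomogeneous_X_pow 0 p).mul (isHomogeneous_X_pow 1 q))
    · have h1 : ∑ j, m (.inl j) = ∑ j, (m - u) (.inl j) + ∑ j, u (.inl j) := by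
        rw [← Finset.sum_add_distrib]
        exact Finset.sum_congr rfl fun j _ => by
          have := hu (.inl j)
          simp only [Finsupp.tsub_apply]; omega
      have h2 : ∑ j, u (.inl j) = 1 := by
        simp [u, Finsupp.single_apply]
      omega
    · have h1 := congrArg (Finsupp.weight (scrollWeight a)) (add_tsub_cancel_of_le hu)
      rw [map_add, hwu, hm, zero_add] at h1
      exact h1

lemma mem_scrollRing_iff {a : Fin d → ℕ} {p : BigRing K d} :
    p ∈ scrollRing K a ↔ p.IsWeightedHomogeneous (scrollWeight a) 0 := by
  constructor
  · intro hp
    induction hp using Algebra.adjoin_induction with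
    | mem p hp =>
      obtain ⟨i, g, hg, rfl⟩ := hp
      exact isWeightedHomogeneous_mulVar hg
    | algebraMap r => exact isWeightedHomogeneous_C _ r
    | add p q _ _ hp hq => exact hp.add hq
    | mul p q _ _ hp hq => simpa using hp.mul hq
  · intro hp
    rw [p.as_sum]
    refine sum_mem fun m hm => ?_
    have : monomial m (coeff m p) = coeff m p • monomial m 1 := by simp [smul_monomial]
    rw [this]
    exact Subalgebra.smul_mem _ (monomial_mem_scrollRing a _ m rfl (hp (mem_support_iff.1 hm))) _

/-- The scroll ring is graded by the degree in `s₁,…,s_d`. -/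
lemma weightedHomogeneousComponent_mem_scrollRing {a : Fin d → ℕ} {p : BigRing K d}
    (hp : p ∈ scrollRing K a) (j : ℕ) :
    weightedHomogeneousComponent (varWeight d) j p ∈ scrollRing K a := by
  classical
  rw [mem_scrollRing_iff] at hp ⊢
  intro m hm
  rw [coeff_weightedHomogeneousComponent] at hm
  split_ifs at hm with h
  · exact hp hm
  · exact absurd rfl hm

/-! ### The algebra map defined by syzygies -/

lemma mulVar_zero (i : Fin d) : mulVar (0 : PlaneRing K) i = 0 := by simp [mulVar]

lemma mulVar_sum {ι : Type*} (s : Finset ι) (g : ι → PlaneRing K) (i : Fin d) :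
    mulVar (∑ j ∈ s, g j) i = ∑ j ∈ s, mulVar (g j) i := by
  simp [mulVar, Finset.sum_mul]

/-- The homomorphism `A[s₁,…,s_d] → A[t₁,…,t_e]` of `A`-algebras with `sᵢ ↦ ∑ⱼ zⱼᵢ tⱼ`, that is,
the map of symmetric algebras induced by the transpose of the matrix with rows `z₁,…,z_e`. -/
def syzygyMap (Z : Fin e → Fin d → PlaneRing K) : BigRing K d →ₐ[K] BigRing K e :=
  aeval (Sum.elim (fun i => ∑ j, mulVar (Z j i) j) (fun v => X (.inr v)))

lemma syzygyMap_rename (Z : Fin e → Fin d → PlaneRing K) (g : PlaneRing K) :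
    syzygyMap Z (rename Sum.inr g) = rename Sum.inr g := by
  rw [syzygyMap, aeval_rename, rename_eq_aeval]
  rfl

lemma syzygyMap_mulVar (Z : Fin e → Fin d → PlaneRing K) (g : PlaneRing K) (i : Fin d) :
    syzygyMap Z (mulVar g i) = ∑ j, mulVar (g * Z j i) j := by
  rw [mulVar, map_mul, syzygyMap_rename]
  simp [syzygyMap, mulVar, Finset.mul_sum, mul_assoc]

lemma syzygyMap_sum_mulVar (Z : Fin e → Fin d → PlaneRing K) (w : Fin d → PlaneRing K) :
    syzygyMap Z (∑ i, mulVar (w i) i) = ∑ j, mulVar (∑ i, w i * Z j i) j := by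
  simp only [map_sum, syzygyMap_mulVar, mulVar_sum]
  exact Finset.sum_comm

lemma IsShiftedHomogeneous.isHomogeneous_mul {a : Fin d → ℕ} {z : Fin d → PlaneRing K} {b : ℕ}
    (hz : IsShiftedHomogeneous a z b) {g : PlaneRing K} {i : Fin d} (hg : g.IsHomogeneous (a i)) :
    (g * z i).IsHomogeneous b := by
  rcases hz i with h | ⟨k, rfl, h⟩
  · rw [h, mul_zero]; exact isHomogeneous_zero _ _ _
  · rw [add_comm]; exact hg.mul h

lemma syzygyMap_mem_scrollRing {a : Fin d → ℕ} {b : Fin e → ℕ} {Z : Fin e → Fin d → PlaneRing K}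
    (hZ : ∀ j, IsShiftedHomogeneous a (Z j) (b j)) {p : BigRing K d} (hp : p ∈ scrollRing K a) :
    syzygyMap Z p ∈ scrollRing K b := by
  induction hp using Algebra.adjoin_induction with
  | mem p hp =>
    obtain ⟨i, g, hg, rfl⟩ := hp
    rw [syzygyMap_mulVar]
    exact sum_mem fun j _ => mulVar_mem_scrollRing ((hZ j).isHomogeneous_mul hg)
  | algebraMap r => rw [AlgHom.commutes]; exact Subalgebra.algebraMap_mem _ r
  | add p q _ _ hp hq => rw [map_add]; exact add_mem hp hq
  | mul p q _ _ hp hq => rw [map_mul]; exact mul_mem hp hq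

lemma isWeightedHomogeneous_mulVar_varWeight (g : PlaneRing K) (i : Fin d) :
    (mulVar g i).IsWeightedHomogeneous (varWeight d) 1 := by
  have h : (rename (Sum.inr : Fin 2 → Fin d ⊕ Fin 2) g).IsWeightedHomogeneous (varWeight d) 0 := by
    intro m hm
    obtain ⟨u, rfl, -⟩ := coeff_rename_ne_zero _ _ _ hm
    rw [Finsupp.weight_apply, Finsupp.sum_mapDomain_index (by simp) (by intros; rw [add_smul])]
    simp
  simpa [mulVar] using h.mul (isWeightedHomogeneous_X K (varWeight d) (.inl i))

/-- The map attached to a matrix over `A` preserves the degree in the variables `s₁,…,s_d`. -/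
lemma syzygyMap_isWeightedHomogeneous (Z : Fin e → Fin d → PlaneRing K) {p : BigRing K d} {n : ℕ}
    (hp : p.IsWeightedHomogeneous (varWeight d) n) :
    (syzygyMap Z p).IsWeightedHomogeneous (varWeight e) n := by
  rw [p.as_sum, map_sum]
  refine IsWeightedHomogeneous.sum _ _ _ fun m hm => ?_
  rw [← hp (mem_support_iff.1 hm), syzygyMap, aeval_monomial, Finsupp.weight_apply]
  rw [← zero_add (Finsupp.sum _ _)]
  refine (isWeightedHomogeneous_C _ _).mul (IsWeightedHomogeneous.prod _ _ _ fun v _ => ?_)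
  refine IsWeightedHomogeneous.pow ?_ _
  rcases v with i | v
  · exact IsWeightedHomogeneous.sum _ _ _ fun j _ => isWeightedHomogeneous_mulVar_varWeight _ _
  · exact isWeightedHomogeneous_X K (varWeight e) (.inr v)

lemma weightedHomogeneousComponent_syzygyMap (Z : Fin e → Fin d → PlaneRing K) (p : BigRing K d)
    (n : ℕ) :
    weightedHomogeneousComponent (varWeight e) n (syzygyMap Z p)
      = syzygyMap Z (weightedHomogeneousComponent (varWeight d) n p) := by
  classical
  have hs := weightedHomogeneousComponent_finsupp (w := varWeight d) p
  have h : ∀ m, weightedHomogeneousComponent (varWeight e) n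
      (syzygyMap Z (weightedHomogeneousComponent (varWeight d) m p))
        = if m = n then syzygyMap Z (weightedHomogeneousComponent (varWeight d) m p) else 0 := by
    intro m
    have := syzygyMap_isWeightedHomogeneous Z
      (weightedHomogeneousComponent_isWeightedHomogeneous (w := varWeight d) m p)
    split_ifs with hmn
    · subst hmn
      exact weightedHomogeneousComponent_eq_self this
    · exact this.weightedHomogeneousComponent_ne n (Ne.symm hmn)
  conv_lhs => rw [← sum_weightedHomogeneousComponent (varWeight d) p, finsum_eq_sum _ hs]
  simp only [map_sum, h, Finset.sum_ite_eq']
  split_ifs with hn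
  · rfl
  · have h0 : weightedHomogeneousComponent (varWeight d) n p = 0 := by
      by_contra h0
      exact hn ((Set.Finite.mem_toFinset hs).2 h0)
    rw [h0, map_zero]

/-- Let `f k` become a unit and `L = ∑ᵢ fᵢ sᵢ` become zero in `Q`. The Koszul syzygies
`f_k e_l - f_l e_k = ∑ⱼ c_{lj} z_j` give the map `tⱼ ↦ f_k⁻¹ ∑ₗ c_{lj} s_l` to `Q`, and its
composite with `syzygyMap Z` is the given map to `Q`. -/
lemma map_eq_zero_of_syzygyMap_eq_zero {f : Fin d → PlaneRing K}
    {Z : Fin e → Fin d → PlaneRing K}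
    (hspan : ∀ w : Fin d → PlaneRing K, ∑ i, w i * f i = 0 →
      ∃ c : Fin e → PlaneRing K, ∀ i, w i = ∑ j, c j * Z j i)
    (k : Fin d) {Q : Type*} [CommRing Q] [Algebra K Q] (q : BigRing K d →ₐ[K] Q)
    (hqL : q (∑ i, mulVar (f i) i) = 0) (v : Q) (hv : v * q (rename Sum.inr (f k)) = 1)
    {u : BigRing K d} (hu : syzygyMap Z u = 0) : q u = 0 := by
  classical
  have hkoszul : ∀ l, ∃ c : Fin e → PlaneRing K,
      ∀ i, (if l = i then f k else 0) - (if k = i then f l else 0) = ∑ j, c j * Z j i := by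
    refine fun l => hspan _ ?_
    simp only [sub_mul, ite_mul, zero_mul, Finset.sum_sub_distrib, Finset.sum_ite_eq,
      Finset.mem_univ, if_true]
    ring
  choose c hc using hkoszul
  let Θ : BigRing K e →ₐ[K] Q :=
    aeval (Sum.elim (fun j => v * q (∑ l, mulVar (c l j) l)) (fun x => q (X (.inr x))))
  have hΘ : ∀ g : PlaneRing K, Θ (rename Sum.inr g) = q (rename Sum.inr g) := by
    intro g
    have h : Θ.comp (rename Sum.inr) = q.comp (rename Sum.inr) := by
      ext x
      simp [Θ]
    exact DFunLike.congr_fun h g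
  have hΘt : ∀ j, Θ (X (.inl j)) = v * q (∑ l, mulVar (c l j) l) := by
    intro j; simp [Θ]
  have hmat : ∀ i, ∑ j, rename Sum.inr (Z j i) * ∑ l, mulVar (c l j) l
      = rename Sum.inr (f k) * X (.inl i) - if k = i then ∑ l, mulVar (f l) l else 0 := by
    intro i
    calc ∑ j, rename Sum.inr (Z j i) * ∑ l, mulVar (c l j) l
        = ∑ l, mulVar (∑ j, c l j * Z j i) l := by
          simp only [Finset.mul_sum, mulVar_sum]
          rw [Finset.sum_comm]
          refine Finset.sum_congr rfl fun l _ => Finset.sum_congr rfl fun j _ => ?_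
          simp only [mulVar, map_mul]
          ring
      _ = _ := by
          simp only [← hc, mulVar, map_sub, sub_mul, Finset.sum_sub_distrib]
          congr 1
          · simp [apply_ite, ite_mul]
          · split_ifs <;> simp
  have hcomp : Θ.comp (syzygyMap Z) = q := by
    apply algHom_ext
    rintro (i | x)
    · rw [AlgHom.comp_apply]
      calc Θ (syzygyMap Z (X (.inl i)))
          = Θ (∑ j, rename Sum.inr (Z j i) * X (.inl j)) := by
            simp only [syzygyMap, aeval_X, Sum.elim_inl, mulVar]
        _ = v * q (∑ j, rename Sum.inr (Z j i) * ∑ l, mulVar (c l j) l) := by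
            rw [map_sum, map_sum, Finset.mul_sum]
            refine Finset.sum_congr rfl fun j _ => ?_
            rw [map_mul, map_mul, hΘ, hΘt, mul_left_comm]
        _ = q (X (.inl i)) := by
            rw [hmat, map_sub, map_mul, mul_sub, ← mul_assoc, hv, one_mul]
            split_ifs <;> simp [hqL]
    · simp [syzygyMap, Θ]
  rw [← hcomp, AlgHom.comp_apply, hu, map_zero]

/-- Away from the zero locus of `f k`, the kernel of `syzygyMap Z` is generated by
`L = ∑ᵢ fᵢ sᵢ`. -/
lemma exists_pow_mul_eq_of_syzygyMap_eq_zero {f : Fin d → PlaneRing K}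
    {Z : Fin e → Fin d → PlaneRing K}
    (hspan : ∀ w : Fin d → PlaneRing K, ∑ i, w i * f i = 0 →
      ∃ c : Fin e → PlaneRing K, ∀ i, w i = ∑ j, c j * Z j i)
    (k : Fin d) {u : BigRing K d} (hu : syzygyMap Z u = 0) :
    ∃ (N : ℕ) (w : BigRing K d),
      rename Sum.inr (f k) ^ N * u = (∑ i, mulVar (f i) i) * w := by
  let I : Ideal (BigRing K d) := Ideal.span {∑ i, mulVar (f i) i}
  let φk : BigRing K d ⧸ I := Ideal.Quotient.mkₐ K I (rename Sum.inr (f k))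
  let q : BigRing K d →ₐ[K] Localization.Away φk :=
    (IsScalarTower.toAlgHom K (BigRing K d ⧸ I) _).comp (Ideal.Quotient.mkₐ K I)
  have hqL : q (∑ i, mulVar (f i) i) = 0 := by
    have : Ideal.Quotient.mkₐ K I (∑ i, mulVar (f i) i) = 0 :=
      Ideal.Quotient.eq_zero_iff_mem.2 (Ideal.mem_span_singleton_self _)
    rw [AlgHom.comp_apply, this, map_zero]
  have hunit : IsUnit (q (rename Sum.inr (f k))) :=
    IsLocalization.Away.algebraMap_isUnit (S := Localization.Away φk) φk
  obtain ⟨v, hv⟩ := hunit.exists_left_inv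
  have hqu : q u = 0 := map_eq_zero_of_syzygyMap_eq_zero hspan k q hqL v hv hu
  obtain ⟨⟨_, N, rfl⟩, hm⟩ := (IsLocalization.map_eq_zero_iff (Submonoid.powers φk)
    (Localization.Away φk) (Ideal.Quotient.mkₐ K I u)).1 hqu
  have hmem : rename Sum.inr (f k) ^ N * u ∈ I := by
    rw [← Ideal.Quotient.eq_zero_iff_mem, map_mul, map_pow]
    exact hm
  exact ⟨N, Ideal.mem_span_singleton.1 hmem⟩

/-! ### The kernel on the scroll ring -/

lemma mem_span_scrollForm_iff {a : Fin d → ℕ} {f : Fin d → PlaneRing K}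
    (hf : ∀ i, (f i).IsHomogeneous (a i)) {u : scrollRing K a} :
    u ∈ Ideal.span {scrollForm a f hf} ↔
      ∃ r ∈ scrollRing K a, (u : BigRing K d) = (∑ i, mulVar (f i) i) * r := by
  rw [Ideal.mem_span_singleton]
  constructor
  · rintro ⟨r, rfl⟩
    exact ⟨r, r.2, rfl⟩
  · rintro ⟨r, hr, h⟩
    exact ⟨⟨r, hr⟩, Subtype.ext h⟩

/-- `L = ∑ᵢ fᵢ sᵢ` does not divide a nonzero product `g sᵢᴺ` when some `f k` with `k ≠ i` is not
zero: the substitution `s_k = -f_i`, `s_i = f_k`, and zero for the other variables, kills `L`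
but not the product. -/
lemma not_dvd_rename_mul_X_pow {f : Fin d → PlaneRing K} {i k : Fin d} (hik : i ≠ k)
    (hk : f k ≠ 0) {g : PlaneRing K} (hg : g ≠ 0) (N : ℕ) :
    ¬ (∑ l, mulVar (f l) l) ∣ rename Sum.inr g * X (.inl i : Fin d ⊕ Fin 2) ^ N := by
  classical
  rintro ⟨r, hr⟩
  let ev : BigRing K d →ₐ[K] PlaneRing K :=
    aeval (Sum.elim (fun l => if l = k then -f i else if l = i then f k else 0) X)
  have hev : ∀ h : PlaneRing K, ev (rename Sum.inr h) = h := by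
    intro h
    simp only [ev]
    rw [aeval_rename]
    exact aeval_X_left_apply h
  have hL : ev (∑ l, mulVar (f l) l) = 0 := by
    simp only [map_sum, mulVar, map_mul, hev]
    rw [Fintype.sum_eq_add i k hik]
    · simp [ev, hik]; ring
    · intro l hl; simp [ev, hl.1, hl.2]
  have h := congrArg ev hr
  rw [map_mul, map_mul, hL, zero_mul, hev, map_pow] at h
  have : ev (X (.inl i)) = f k := by simp [ev, hik]
  rw [this] at h
  exact mul_ne_zero hg (pow_ne_zero N hk) h

/-- If `(L)` is prime, the kernel of `R(a₁,…,a_d) → A[t₁,…,t_e]` is `(L)`. For `u` in the kernel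
some `f_kᴺ u` is a multiple of `L` in `B`. With `i ≠ k`, the element
`m = f_k x^{a_k(a_i - 1)} sᵢ^{a_k}` of the scroll ring is not in `(L)`, and `mᴺ u` is a multiple of
`L` in the scroll ring, by projection to weight `0`. -/
lemma mem_span_scrollForm_of_syzygyMap_eq_zero {a : Fin d → ℕ} (ha : ∀ i, 0 < a i)
    {f : Fin d → PlaneRing K} (hf : ∀ i, (f i).IsHomogeneous (a i))
    (hL : (Ideal.span {scrollForm a f hf}).IsPrime)
    {Z : Fin e → Fin d → PlaneRing K}
    (hspan : ∀ w : Fin d → PlaneRing K, ∑ i, w i * f i = 0 →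
      ∃ c : Fin e → PlaneRing K, ∀ i, w i = ∑ j, c j * Z j i)
    {i k : Fin d} (hik : i ≠ k) (hk : f k ≠ 0)
    {u : scrollRing K a} (hu : syzygyMap Z (u : BigRing K d) = 0) :
    u ∈ Ideal.span {scrollForm a f hf} := by
  obtain ⟨N, w, hw⟩ := exists_pow_mul_eq_of_syzygyMap_eq_zero hspan k hu
  let g : PlaneRing K := X 0 ^ (a k * (a i - 1))
  have hg : g ≠ 0 := pow_ne_zero _ (X_ne_zero 0)
  let m : BigRing K d := rename Sum.inr (f k * g) * X (.inl i) ^ a k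
  have hm : m ∈ scrollRing K a := by
    rw [mem_scrollRing_iff]
    have h := (isWeightedHomogeneous_rename ((hf k).mul
      (isHomogeneous_X_pow (R := K) (0 : Fin 2) (a k * (a i - 1)))) a).mul
      ((isWeightedHomogeneous_X K (scrollWeight a) (.inl i)).pow (a k))
    convert h using 1
    obtain ⟨n, hn⟩ := Nat.exists_eq_succ_of_ne_zero (ha i).ne'
    simp [scrollWeight, hn]
    ring
  have hmu : m ^ N * (u : BigRing K d) = (∑ l, mulVar (f l) l) *
      ((rename Sum.inr g * X (.inl i) ^ a k) ^ N * w) := by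
    rw [mul_left_comm, ← hw]
    simp only [m, map_mul]
    ring
  have hmem : (⟨m, hm⟩ : scrollRing K a) ^ N * u ∈ Ideal.span {scrollForm a f hf} := by
    rw [mem_span_scrollForm_iff]
    refine ⟨weightedHomogeneousComponent (scrollWeight a) 0
      ((rename Sum.inr g * X (.inl i) ^ a k) ^ N * w), ?_, ?_⟩
    · exact mem_scrollRing_iff.2 (weightedHomogeneousComponent_isWeightedHomogeneous _ _)
    · have hL0 : (∑ l, mulVar (f l) l).IsWeightedHomogeneous (scrollWeight a) 0 :=
        mem_scrollRing_iff.1 (scrollForm a f hf).2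
      have hmu0 := mem_scrollRing_iff.1 (mul_mem (pow_mem hm N) u.2)
      rw [← weightedHomogeneousComponent_mul_of_left_zero hL0, ← hmu,
        weightedHomogeneousComponent_eq_self hmu0]
      rfl
  refine (hL.mem_or_mem hmem).resolve_left fun h => ?_
  obtain ⟨r, -, hr⟩ := (mem_span_scrollForm_iff hf).1 (hL.mem_of_pow_mem N h)
  exact not_dvd_rename_mul_X_pow hik hk (mul_ne_zero hk hg) (a k) ⟨r, hr⟩

/-- A multiple of `L = ∑ᵢ fᵢ sᵢ` in the scroll ring that is linear in `s₁,…,s_d` is a scalar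
multiple of `L`. -/
lemma exists_smul_eq_of_sum_mulVar_eq {a : Fin d → ℕ}
    {f w : Fin d → PlaneRing K} {r : BigRing K d} (hr : r ∈ scrollRing K a)
    (h : ∑ i, mulVar (w i) i = (∑ i, mulVar (f i) i) * r) : ∃ c : K, w = c • f := by
  classical
  let ε : BigRing K d →ₐ[K] PlaneRing K := aeval (Sum.elim 0 X)
  have hε : ∀ g : PlaneRing K, ε (rename Sum.inr g) = g := by
    intro h
    simp only [ε]
    rw [aeval_rename]
    exact aeval_X_left_apply h
  have hX : ∀ i, ε (X (.inl i)) = 0 := by intro i; simp [ε]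
  have hlin : ∀ (g : Fin d → PlaneRing K) i, ε (pderiv (.inl i) (∑ l, mulVar (g l) l)) = g i := by
    intro g i
    have : ∀ l, ε (pderiv (.inl i) (mulVar (g l) l)) = if l = i then g l else 0 := by
      intro l
      simp only [mulVar, Derivation.leibniz, smul_eq_mul, map_add, map_mul, hX, hε, pderiv_X]
      by_cases hl : l = i
      · subst hl; simp
      · simp [hl]
    simp only [map_sum, this]
    simp
  have hL0 : ε (∑ l, mulVar (f l) l) = 0 := by simp [mulVar, hX]
  obtain ⟨c, hc⟩ : ∃ c : K, ε r = C c := by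
    clear h
    induction hr using Algebra.adjoin_induction with
    | mem p hp =>
      obtain ⟨i, g, -, rfl⟩ := hp
      exact ⟨0, by simp [mulVar, hX]⟩
    | algebraMap r => exact ⟨r, by simp [ε, algebraMap_eq]⟩
    | add p q _ _ hp hq =>
      obtain ⟨c, hc⟩ := hp
      obtain ⟨c', hc'⟩ := hq
      exact ⟨c + c', by simp [hc, hc']⟩
    | mul p q _ _ hp hq =>
      obtain ⟨c, hc⟩ := hp
      obtain ⟨c', hc'⟩ := hq
      exact ⟨c * c', by simp [hc, hc']⟩
  refine ⟨c, funext fun i => ?_⟩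
  rw [← hlin w i, h, Derivation.leibniz, map_add, smul_eq_mul, smul_eq_mul, map_mul, map_mul, hL0,
    hlin, hc, zero_mul, zero_add, Pi.smul_apply, smul_eq_C_mul]

/-! ### Dimension counts -/

instance (n : ℕ) : FiniteDimensional K (homogeneousSubmodule (Fin 2) K n) :=
  Module.Finite.iff_fg.2 (homogeneousSubmodule_fg (σ := Fin 2) (R := K) n)

lemma finrank_homogeneousSubmodule_fin_two (n : ℕ) :
    Module.finrank K (homogeneousSubmodule (Fin 2) K n) = n + 1 := by
  classical
  rw [homogeneousSubmodule_eq_finsupp_supported]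
  rw [(AddMonoidAlgebra.supportedEquivFinsupp (R := K) (S := K)
    {m : Fin 2 →₀ ℕ | m.degree = n}).finrank_eq]
  let E : {m : Fin 2 →₀ ℕ | m.degree = n} ≃ Finset.HasAntidiagonal.antidiagonal n :=
    { toFun := fun m => ⟨(m.1 0, m.1 1), by
        have := m.2
        simpa [Finsupp.degree_eq_sum] using this⟩
      invFun := fun p => ⟨.single 0 p.1.1 + .single 1 p.1.2, by
        simpa [Finsupp.degree_eq_sum] using Finset.HasAntidiagonal.mem_antidiagonal.1 p.2⟩
      left_inv := fun m => by
        ext v; fin_cases v <;> simp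
      right_inv := fun p => by
        ext; simp }
  rw [(Finsupp.domLCongr E).finrank_eq, Module.finrank_finsupp_self, Fintype.card_coe,
    Finset.Nat.card_antidiagonal]

lemma finrank_pi_homogeneousSubmodule_fin_two (n : Fin d → ℕ) :
    Module.finrank K (∀ i, homogeneousSubmodule (Fin 2) K (n i)) = ∑ i, (n i + 1) := by
  rw [Module.finrank_pi_fintype]
  simp only [finrank_homogeneousSubmodule_fin_two]

/-- A homogeneous syzygy is a combination of homogeneous generators with homogeneous
coefficients. -/
lemma exists_isHomogeneous_combination {a : Fin d → ℕ} {b : Fin e → ℕ}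
    {Z : Fin e → Fin d → PlaneRing K} (hZ : ∀ j, IsShiftedHomogeneous a (Z j) (b j))
    {n : ℕ} (ha : ∀ i, a i ≤ n) (hb : ∀ j, b j ≤ n) {w : Fin d → PlaneRing K}
    (hw : ∀ i, (w i).IsHomogeneous (n - a i)) {c : Fin e → PlaneRing K}
    (hc : ∀ i, w i = ∑ j, c j * Z j i) (i : Fin d) :
    w i = ∑ j, homogeneousComponent (n - b j) (c j) * Z j i := by
  rw [← homogeneousComponent_eq_self (hw i), hc, map_sum]
  refine Finset.sum_congr rfl fun j _ => ?_
  rcases hZ j i with h | ⟨k, hk, h⟩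
  · simp [h]
  · have hn : n - a i = (n - b j) + k := by
      have := ha i
      have := hb j
      omega
    rw [hn, homogeneousComponent_mul_of_isHomogeneous h]

/-- Generators of degrees `b₁,…,b_{d-1}` of the syzygy module satisfy `∑ bⱼ ≤ ∑ aᵢ`: for `n` large,
the syzygies of degree `n` form the kernel of a map `⊕ᵢ A_{n-aᵢ} → A_n` and the image of a map from
`⊕ⱼ A_{n-bⱼ}`, and `A_m` has dimension `m + 1`. -/
lemma sum_degree_le_of_span_syzygies {a : Fin d → ℕ} {b : Fin e → ℕ} (hde : d = e + 1)
    {f : Fin d → PlaneRing K} (hf : ∀ i, (f i).IsHomogeneous (a i))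
    {Z : Fin e → Fin d → PlaneRing K} (hZ : ∀ j, IsShiftedHomogeneous a (Z j) (b j))
    (hspan : ∀ w : Fin d → PlaneRing K, ∑ i, w i * f i = 0 →
      ∃ c : Fin e → PlaneRing K, ∀ i, w i = ∑ j, c j * Z j i) :
    ∑ j, b j ≤ ∑ i, a i := by
  let n := ∑ i, a i + ∑ j, b j
  have ha : ∀ i, a i ≤ n := fun i =>
    (Finset.single_le_sum (fun _ _ => Nat.zero_le _) (Finset.mem_univ i)).trans
      (Nat.le_add_right _ _)
  have hb : ∀ j, b j ≤ n := fun j =>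
    (Finset.single_le_sum (fun _ _ => Nat.zero_le _) (Finset.mem_univ j)).trans
      (Nat.le_add_left _ _)
  let S₀ : (∀ i, homogeneousSubmodule (Fin 2) K (n - a i)) →ₗ[K] PlaneRing K :=
    ∑ i, LinearMap.mulRight K (f i) ∘ₗ Submodule.subtype _ ∘ₗ LinearMap.proj i
  have hS₀ : ∀ w, S₀ w = ∑ i, (w i : PlaneRing K) * f i := by
    intro w; simp [S₀]
  let S : (∀ i, homogeneousSubmodule (Fin 2) K (n - a i)) →ₗ[K] homogeneousSubmodule (Fin 2) K n :=
    S₀.codRestrict _ fun w => by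
      rw [hS₀]
      refine Submodule.sum_mem _ fun i _ => ?_
      have := (w i).2.mul (hf i)
      rwa [Nat.sub_add_cancel (ha i)] at this
  let G : (∀ j, homogeneousSubmodule (Fin 2) K (n - b j)) →ₗ[K] (Fin d → PlaneRing K) :=
    LinearMap.pi fun i =>
      ∑ j, LinearMap.mulRight K (Z j i) ∘ₗ Submodule.subtype _ ∘ₗ LinearMap.proj j
  let ι : (∀ i, homogeneousSubmodule (Fin 2) K (n - a i)) →ₗ[K] (Fin d → PlaneRing K) :=
    LinearMap.pi fun i => Submodule.subtype _ ∘ₗ LinearMap.proj i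
  have hι : Function.Injective ι := fun w w' h =>
    funext fun i => Subtype.ext (congrFun h i)
  have hker : (LinearMap.ker S).map ι ≤ LinearMap.range G := by
    rintro _ ⟨w, hw, rfl⟩
    have h0 : ∑ i, (w i : PlaneRing K) * f i = 0 := by
      rw [← hS₀]; exact congrArg Subtype.val hw
    obtain ⟨c, hc⟩ := hspan _ h0
    refine ⟨fun j => ⟨homogeneousComponent (n - b j) (c j),
      homogeneousComponent_isHomogeneous _ _⟩, funext fun i => ?_⟩
    have := exists_isHomogeneous_combination hZ ha hb (fun i => (w i).2) hc i
    simp only [ι, G, LinearMap.pi_apply, LinearMap.coe_comp, Function.comp_apply,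
      LinearMap.proj_apply, Submodule.subtype_apply, LinearMap.coe_sum, Finset.sum_apply,
      LinearMap.mulRight_apply]
    exact this.symm
  have h1 := S.finrank_range_add_finrank_ker
  have h2 := (LinearMap.range S).finrank_le
  have h3 := Submodule.finrank_mono hker
  have h4 := G.finrank_range_le
  rw [← (Submodule.equivMapOfInjective ι hι _).finrank_eq] at h3
  rw [finrank_pi_homogeneousSubmodule_fin_two] at h1 h4
  rw [finrank_homogeneousSubmodule_fin_two] at h2
  have hA : ∑ i, (n - a i + 1) + ∑ i, a i = d * (n + 1) := by
    rw [← Finset.sum_add_distrib, Finset.sum_congr rfl (g := fun _ => n + 1), Finset.sum_const]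
    · simp
    · intro i _; have := ha i; omega
  have hB : ∑ j, (n - b j + 1) + ∑ j, b j = e * (n + 1) := by
    rw [← Finset.sum_add_distrib, Finset.sum_congr rfl (g := fun _ => n + 1), Finset.sum_const]
    · simp
    · intro j _; have := hb j; omega
  have hd : d * (n + 1) = e * (n + 1) + (n + 1) := by rw [hde, add_mul, one_mul]
  omega

/-- If the transposed matrix `⊕ᵢ A_{aᵢ} → ⊕ⱼ A_{bⱼ}` kills only multiples of `f`, and
`∑ bⱼ ≤ ∑ aᵢ`, it is surjective, by dimension. -/
lemma exists_transpose_eq {a : Fin d → ℕ} {b : Fin e → ℕ} (hde : d = e + 1)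
    (hab : ∑ j, b j ≤ ∑ i, a i)
    {f : Fin d → PlaneRing K} (hf : ∀ i, (f i).IsHomogeneous (a i))
    {Z : Fin e → Fin d → PlaneRing K} (hZ : ∀ j, IsShiftedHomogeneous a (Z j) (b j))
    (hker : ∀ w : Fin d → PlaneRing K, (∀ i, (w i).IsHomogeneous (a i)) →
      (∀ j, ∑ i, w i * Z j i = 0) → ∃ c : K, w = c • f)
    {v : Fin e → PlaneRing K} (hv : ∀ j, (v j).IsHomogeneous (b j)) :
    ∃ w : Fin d → PlaneRing K, (∀ i, (w i).IsHomogeneous (a i)) ∧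
      ∀ j, ∑ i, w i * Z j i = v j := by
  let T₀ : Fin e → (∀ i, homogeneousSubmodule (Fin 2) K (a i)) →ₗ[K] PlaneRing K := fun j =>
    ∑ i, LinearMap.mulRight K (Z j i) ∘ₗ Submodule.subtype _ ∘ₗ LinearMap.proj i
  have hT₀ : ∀ j w, T₀ j w = ∑ i, (w i : PlaneRing K) * Z j i := by
    intro j w; simp [T₀]
  let T : (∀ i, homogeneousSubmodule (Fin 2) K (a i)) →ₗ[K]
      (∀ j, homogeneousSubmodule (Fin 2) K (b j)) :=
    LinearMap.pi fun j => (T₀ j).codRestrict _ fun w => by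
      rw [hT₀]
      exact Submodule.sum_mem _ fun i _ => (hZ j).isHomogeneous_mul (w i).2
  have hT : ∀ w j, ((T w j : _) : PlaneRing K) = ∑ i, (w i : PlaneRing K) * Z j i :=
    fun w j => hT₀ j w
  have hle : LinearMap.ker T ≤
      Submodule.span K {(fun i => ⟨f i, hf i⟩ : ∀ i, homogeneousSubmodule (Fin 2) K (a i))} := by
    intro w hw
    obtain ⟨c, hc⟩ := hker (fun i => w i) (fun i => (w i).2) fun j => by
      rw [← hT, LinearMap.mem_ker.1 hw]; rfl
    exact Submodule.mem_span_singleton.2 ⟨c, funext fun i => Subtype.ext (congrFun hc i).symm⟩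
  have h1 := T.finrank_range_add_finrank_ker
  have h2 := (Submodule.finrank_mono hle).trans (finrank_span_le_card _)
  have h3 := (LinearMap.range T).finrank_le
  have hB := finrank_pi_homogeneousSubmodule_fin_two (K := K) b
  rw [finrank_pi_homogeneousSubmodule_fin_two] at h1
  rw [Set.toFinset_singleton, Finset.card_singleton] at h2
  have htop : LinearMap.range T = ⊤ := by
    apply Submodule.eq_top_of_finrank_eq
    rw [hB] at h3 ⊢
    simp only [Finset.sum_add_distrib, Finset.sum_const, Finset.card_univ, Fintype.card_fin,
      smul_eq_mul, mul_one] at h1 h3 ⊢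
    omega
  obtain ⟨w, hw⟩ := LinearMap.range_eq_top.1 htop fun j => ⟨v j, hv j⟩
  exact ⟨fun i => w i, fun i => (w i).2, fun j => by rw [← hT, hw]⟩

/-! ### The map of scroll rings -/

/-- The map `R(a₁,…,a_d) → R(b₁,…,b_e)` induced by `syzygyMap`. -/
def scrollMap {a : Fin d → ℕ} {b : Fin e → ℕ} {Z : Fin e → Fin d → PlaneRing K}
    (hZ : ∀ j, IsShiftedHomogeneous a (Z j) (b j)) : scrollRing K a →ₐ[K] scrollRing K b :=
  ((syzygyMap Z).comp (scrollRing K a).val).codRestrict _ fun p => syzygyMap_mem_scrollRing hZ p.2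

/-- The scroll ring is generated in degree `1`, so surjectivity of `scrollMap` follows from
surjectivity in degree `1`. -/
lemma scrollMap_surjective {a : Fin d → ℕ} {b : Fin e → ℕ} {Z : Fin e → Fin d → PlaneRing K}
    (hZ : ∀ j, IsShiftedHomogeneous a (Z j) (b j))
    (hlin : ∀ v : Fin e → PlaneRing K, (∀ j, (v j).IsHomogeneous (b j)) →
      ∃ w : Fin d → PlaneRing K, (∀ i, (w i).IsHomogeneous (a i)) ∧
        ∀ j, ∑ i, w i * Z j i = v j) :
    Function.Surjective (scrollMap hZ) := by
  classical
  have hle : scrollRing K b ≤ (scrollRing K a).map (syzygyMap Z) := by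
    refine Algebra.adjoin_le ?_
    rintro _ ⟨j, g, hg, rfl⟩
    obtain ⟨w, hw, hwv⟩ := hlin (Pi.single j g) fun l => by
      by_cases h : l = j
      · subst h; simpa using hg
      · rw [Pi.single_eq_of_ne h]; exact isHomogeneous_zero _ _ _
    refine ⟨∑ i, mulVar (w i) i, sum_mem fun i _ => mulVar_mem_scrollRing (hw i), ?_⟩
    change syzygyMap Z (∑ i, mulVar (w i) i) = _
    rw [syzygyMap_sum_mulVar]
    simp only [hwv]
    rw [Finset.sum_eq_single j]
    · simp
    · intro l _ hl; rw [Pi.single_eq_of_ne hl, mulVar_zero]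
    · simp
  intro v
  obtain ⟨u, hu, huv⟩ := hle v.2
  exact ⟨⟨u, hu⟩, Subtype.ext huv⟩

lemma map_scrollMap_scrollComponent {a : Fin d → ℕ} {b : Fin e → ℕ}
    {Z : Fin e → Fin d → PlaneRing K} (hZ : ∀ j, IsShiftedHomogeneous a (Z j) (b j))
    (hsurj : Function.Surjective (scrollMap hZ)) (n : ℕ) :
    (scrollComponent K a n).map (scrollMap hZ).toLinearMap = scrollComponent K b n := by
  apply le_antisymm
  · rintro _ ⟨u, hu, rfl⟩
    exact syzygyMap_isWeightedHomogeneous Z hu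
  · intro v hv
    obtain ⟨u, rfl⟩ := hsurj v
    refine ⟨⟨weightedHomogeneousComponent (varWeight d) n u,
      weightedHomogeneousComponent_mem_scrollRing u.2 n⟩,
      weightedHomogeneousComponent_isWeightedHomogeneous _ _, Subtype.ext ?_⟩
    change syzygyMap Z (weightedHomogeneousComponent (varWeight d) n u) = syzygyMap Z u
    rw [← weightedHomogeneousComponent_syzygyMap]
    exact weightedHomogeneousComponent_eq_self hv

end

theorem mainTheorem1 {K : Type*} [Field K] (d : ℕ) (hd : 2 ≤ d)
    (a : Fin d → ℕ) (ha : ∀ i, 0 < a i)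
    (f : Fin d → PlaneRing K) (hf : ∀ i, (f i).IsHomogeneous (a i))
    (hL : (Ideal.span {scrollForm a f hf}).IsPrime)
    (b : Fin (d - 1) → ℕ)
    (z : Module.Basis (Fin (d - 1)) (PlaneRing K) (syzygyModule f))
    (hz : ∀ j, IsShiftedHomogeneous a (z j : Fin d → PlaneRing K) (b j)) :
    ∃ φ : (scrollRing K a ⧸ Ideal.span {scrollForm a f hf}) ≃ₐ[K] scrollRing K b,
      ∀ j : ℕ,
        (scrollQuotientComponent K a (Ideal.span {scrollForm a f hf}) j).map
            φ.toLinearEquiv.toLinearMap =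
          scrollComponent K b j := by
  classical
  have hde : d = (d - 1) + 1 := by omega
  have hmem : ∀ w : Fin d → PlaneRing K, w ∈ syzygyModule f ↔ ∑ i, w i * f i = 0 := by
    intro w
    simp [syzygyModule, Fintype.linearCombination_apply]
  have hspan : ∀ w : Fin d → PlaneRing K, ∑ i, w i * f i = 0 →
      ∃ c : Fin (d - 1) → PlaneRing K,
        ∀ i, w i = ∑ j, c j * (z j : Fin d → PlaneRing K) i := by
    intro w hw
    refine ⟨z.repr ⟨w, (hmem w).2 hw⟩, fun i => ?_⟩
    have h := congrFun (congrArg Subtype.val (z.sum_repr ⟨w, (hmem w).2 hw⟩)) i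
    rw [Submodule.coe_sum, Finset.sum_apply] at h
    exact h.symm
  -- for `f = 0` the syzygy module would be free of rank `d`, not `d - 1`
  obtain ⟨k, hk⟩ : ∃ k, f k ≠ 0 := by
    by_contra! h
    have htop : syzygyModule f = ⊤ := by
      rw [eq_top_iff]
      intro w _
      simp [hmem, h]
    have h1 := Module.finrank_eq_card_basis z
    rw [htop, finrank_top, Module.finrank_fin_fun, Fintype.card_fin] at h1
    omega
  obtain ⟨i, hik⟩ : ∃ i, i ≠ k := by
    have : Nontrivial (Fin d) := Fin.nontrivial_iff_two_le.2 hd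
    exact exists_ne k
  have hker : ∀ u : scrollRing K a, scrollMap hz u = 0 → u ∈ Ideal.span {scrollForm a f hf} :=
    fun u hu => mem_span_scrollForm_of_syzygyMap_eq_zero ha hf hL hspan hik hk
      (congrArg Subtype.val hu)
  have hL0 : scrollMap hz (scrollForm a f hf) = 0 := by
    apply Subtype.ext
    change syzygyMap _ (∑ i, mulVar (f i) i) = 0
    rw [syzygyMap_sum_mulVar]
    refine Finset.sum_eq_zero fun j _ => ?_
    have := (hmem _).1 (z j).2
    simp only [mul_comm (f _), this, mulVar_zero]
  have hsurj : Function.Surjective (scrollMap hz) := by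
    refine scrollMap_surjective hz fun v hv => exists_transpose_eq hde
      (sum_degree_le_of_span_syzygies hde hf hz hspan) hf hz (fun w hw hwz => ?_) hv
    have hw0 : scrollMap hz (scrollForm a w hw) = 0 := by
      apply Subtype.ext
      change syzygyMap _ (∑ i, mulVar (w i) i) = 0
      rw [syzygyMap_sum_mulVar]
      exact Finset.sum_eq_zero fun j _ => by rw [hwz, mulVar_zero]
    obtain ⟨r, hr, h⟩ := (mem_span_scrollForm_iff hf).1 (hker _ hw0)
    exact exists_smul_eq_of_sum_mulVar_eq hr h
  have hkerEq : Ideal.span {scrollForm a f hf} = RingHom.ker (scrollMap hz) := by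
    refine le_antisymm ?_ hker
    rw [Ideal.span_le, Set.singleton_subset_iff]
    exact hL0
  let φ : (scrollRing K a ⧸ Ideal.span {scrollForm a f hf}) ≃ₐ[K] scrollRing K b :=
    (Ideal.quotientEquivAlgOfEq K hkerEq).trans
      (Ideal.quotientKerAlgEquivOfSurjective hsurj)
  refine ⟨φ, fun j => ?_⟩
  rw [← map_scrollMap_scrollComponent hz hsurj j, scrollQuotientComponent, ← Submodule.map_comp]
  rfl
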